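/- Let $d\ge 1$ and $Q=[-1,1]^d\subset\mathbb{R}^d$, and let $\mathcal{K}$ be the collection of all non-empty compact subsets of $Q$, equipped with the Hausdorff metric $d_H$. For $x\in\mathbb{R}^d$, $t>0$ and $E\subset\mathbb{R}^d$ put $$T_{x,t}(E)=\Big\{\tfrac{y-x}{t}: y\in E\Big\}\cap Q .$$ For $E\in\mathcal{K}$ and $x\in E$ let $\operatorname{Tan}(E,x)$ be the collection of all $F\in\mathcal{K}$ for which there is a sequence of positive numbers $t_n\searrow 0$ such that $T_{x,t_n}(E)\to F$ in the Hausdorff metric. Let $$\mathcal{K}_0^+=\{K\in\mathcal{K}: 0\in K\text{ and } x_1\ge 0\text{ for all }x=(x_1,\dots,x_d)\in K\}.$$ Then for every $s\in[0,d]$ there exist a set $X\in\mathcal{K}$ with Hausdorff dimension $\dim_H X=s$ and a countable dense subset $E\subset X$ such that $\operatorname{Tan}(X,x)=\mathcal{K}_0^+$ for all $x\in E$. -/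

import Mathlib

open Filter Topology

/-- The cube `Q = [-1,1]^d`. -/
def cubeQ (d : ℕ) : Set (EuclideanSpace ℝ (Fin d)) :=
  {x | ∀ i, x i ∈ Set.Icc (-1 : ℝ) 1}

/-- The collection `𝒦` of all non-empty compact subsets of `Q`. -/
def compactsInQ (d : ℕ) : Set (Set (EuclideanSpace ℝ (Fin d))) :=
  {K | K.Nonempty ∧ IsCompact K ∧ K ⊆ cubeQ d}

/-- `T_{x,t}(E) = {(y - x) / t : y ∈ E} ∩ Q`. -/
def zoom {d : ℕ} (x : EuclideanSpace ℝ (Fin d)) (t : ℝ)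
    (E : Set (EuclideanSpace ℝ (Fin d))) : Set (EuclideanSpace ℝ (Fin d)) :=
  ((fun y => t⁻¹ • (y - x)) '' E) ∩ cubeQ d

/-- `Tan(E, x)`: the sets `F ∈ 𝒦` that are limits, in the Hausdorff metric, of
`T_{x,t_n}(E)` along some sequence of positive numbers `t_n` decreasing to `0`.
For `E ∈ 𝒦` and `x ∈ E` the sets `T_{x,t}(E)` are non-empty (they contain `0`) and compact. -/
def tangentSets {d : ℕ} (E : Set (EuclideanSpace ℝ (Fin d)))
    (x : EuclideanSpace ℝ (Fin d)) : Set (Set (EuclideanSpace ℝ (Fin d))) :=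
  {F | F ∈ compactsInQ d ∧ ∃ t : ℕ → ℝ,
    (∀ n, 0 < t n) ∧ Antitone t ∧ Tendsto t atTop (𝓝 0) ∧
      Tendsto (fun n => Metric.hausdorffEDist (zoom x (t n) E) F) atTop (𝓝 0)}

/-- `𝒦₀⁺`: the sets `K ∈ 𝒦` that contain the origin and on which the first coordinate
(the one with index `0` in `Fin d`) is non-negative. -/
def compactsZeroPlus (d : ℕ) [NeZero d] : Set (Set (EuclideanSpace ℝ (Fin d))) :=
  {K | K ∈ compactsInQ d ∧ 0 ∈ K ∧ ∀ x ∈ K, 0 ≤ x (0 : Fin d)}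

/-! Tangent sets at a point depend only on the set near that point and are invariant under
similarities (`tangentSets_congr_of_inter_ball`, `tangentSets_similarity`). So it suffices to build
a compact `Y` of dimension zero that has the required tangents on a countable dense subset. Tiny,
well separated copies of `Y` are then attached to a compact `C` of dimension `s` with empty
interior, at countably many points outside `C` that accumulate at every point of `C`. The copies add
no dimension, and their distinguished points are dense in the union.

To build `Y`, list the finite subsets of a countable dense set of nonzero points of the half cube,
each infinitely often, and scale them by rapidly decreasing factors `t k`. In the resulting sequence
`P → 0`, the window of scale `t k` shows the `k`-th finite set up to a small error, so every member
of `𝒦₀⁺` is a tangent at `0` (`exists_universal_points`). To get the same behaviour at a dense set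
of points, a small copy of such a set is attached at each `q ∈ P`, and so on recursively. The copies
have size at most `‖q‖ ^ 2`, so blow-ups at `0` do not see them. The ratios shrink with the depth of
the recursion, which makes the closure zero-dimensional (`dimH_closure_wordSet_eq_zero`). No other
tangents occur, because everything stays in the closed half space. -/

/-! ### Similarities and an upper bound for Hausdorff dimension -/

/-- The similarity `y ↦ q + r y`. -/
def similarity {V : Type*} [AddCommGroup V] [Module ℝ V] (q : V) (r : ℝ) (y : V) : V := q + r • y

theorem dist_similarity {V : Type*} [NormedAddCommGroup V] [NormedSpace ℝ V] (q : V) (r : ℝ)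
    (x y : V) : dist (similarity q r x) (similarity q r y) = |r| * dist x y := by
  simp [similarity, dist_eq_norm, ← smul_sub, norm_smul]

theorem lipschitzWith_similarity {V : Type*} [NormedAddCommGroup V] [NormedSpace ℝ V] (q : V)
    (r : ℝ) : LipschitzWith ‖r‖₊ (similarity q r) :=
  LipschitzWith.of_dist_le_mul fun x y => by simp [dist_similarity]

/-- `A` has a countable cover by sets of diameter at most `δ` whose `s`-cost is at most `c`. -/
def HasCover {V : Type*} [PseudoEMetricSpace V] (s : ℝ) (δ c : ENNReal) (A : Set V) : Prop :=
  ∃ (ι : Type) (_ : Countable ι) (U : ι → Set V), A ⊆ ⋃ i, U i ∧ (∀ i, Metric.ediam (U i) ≤ δ) ∧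
    ∑' i, Metric.ediam (U i) ^ s ≤ c

/-- Pushing a cover of `B` through every similarity multiplies its cost by `∑ rᵢ ^ s ≤ 1` and at
least halves the diameters. Iterating gives arbitrarily fine covers of bounded cost, hence finite
`s`-dimensional measure. -/
theorem HasCover.of_subset_iUnion_similarity {V : Type*} [NormedAddCommGroup V] [NormedSpace ℝ V]
    {s : ℝ} (hs : 0 ≤ s) {δ c : ENNReal} {ι : Type} [Countable ι] {q : ι → V} {r : ι → ℝ}
    {A B : Set V} (hr0 : ∀ i, 0 ≤ r i) (hr : ∀ i, r i ≤ 1 / 2)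
    (hsum : ∑' i, ENNReal.ofReal (r i) ^ s ≤ 1)
    (hA : A ⊆ ⋃ i, similarity (q i) (r i) '' B) (hB : HasCover s δ c B) :
    HasCover s (δ / 2) c A := by
  obtain ⟨κ, _, U, hU, hδ, hc⟩ := hB
  have hd : ∀ i k, Metric.ediam (similarity (q i) (r i) '' U k) ≤
      ENNReal.ofReal (r i) * Metric.ediam (U k) := fun i k => by
    have h := (lipschitzWith_similarity (q i) (r i)).ediam_image_le (U k)
    rwa [← Real.toNNReal_eq_nnnorm_of_nonneg (hr0 i)] at h
  refine ⟨ι × κ, inferInstance, fun p => similarity (q p.1) (r p.1) '' U p.2, ?_, ?_, ?_⟩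
  · intro x hx
    obtain ⟨i, y, hy, rfl⟩ := Set.mem_iUnion.1 (hA hx)
    obtain ⟨k, hk⟩ := Set.mem_iUnion.1 (hU hy)
    exact Set.mem_iUnion.2 ⟨(i, k), y, hk, rfl⟩
  · rintro ⟨i, k⟩
    refine (hd i k).trans ?_
    rw [ENNReal.div_eq_inv_mul]
    refine mul_le_mul' ?_ (hδ k)
    rw [ENNReal.ofReal_le_iff_le_toReal (by simp)]
    simpa using hr i
  · calc ∑' p : ι × κ, Metric.ediam (similarity (q p.1) (r p.1) '' U p.2) ^ s
        ≤ ∑' p : ι × κ, ENNReal.ofReal (r p.1) ^ s * Metric.ediam (U p.2) ^ s :=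
          ENNReal.tsum_le_tsum fun p => by
            rw [← ENNReal.mul_rpow_of_nonneg _ _ hs]
            exact ENNReal.rpow_le_rpow (hd _ _) hs
      _ = (∑' i, ENNReal.ofReal (r i) ^ s) * ∑' k, Metric.ediam (U k) ^ s := by
          rw [ENNReal.tsum_prod (f := fun i k => ENNReal.ofReal (r i) ^ s * Metric.ediam (U k) ^ s)]
          simp_rw [ENNReal.tsum_mul_left, ENNReal.tsum_mul_right]
      _ ≤ 1 * c := mul_le_mul' hsum hc
      _ = c := one_mul c

/-- Sets covered by countably many small similar copies of each other have dimension at most `s`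
if the `s`-th powers of the ratios add up to at most one. -/
theorem dimH_le_of_subset_iUnion_similarity {V : Type*} [NormedAddCommGroup V] [NormedSpace ℝ V]
    {s : NNReal} {b : ENNReal} (hb : b ≠ ⊤) {ι : Type} [Countable ι] (q : ι → V)
    (r : ℕ → ι → ℝ) (A : ℕ → Set V) (hr0 : ∀ n i, 0 ≤ r n i) (hr : ∀ n i, r n i ≤ 1 / 2)
    (hsum : ∀ n, ∑' i, ENNReal.ofReal (r n i) ^ (s : ℝ) ≤ 1)
    (hA : ∀ n, A n ⊆ ⋃ i, similarity (q i) (r n i) '' A (n + 1))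
    (hdiam : ∀ n, Metric.ediam (A n) ≤ b) (n : ℕ) : dimH (A n) ≤ s := by
  borelize V
  have key : ∀ k n, HasCover s (b / 2 ^ k) (b ^ (s : ℝ)) (A n) := by
    intro k
    induction k with
    | zero =>
      intro n
      refine ⟨Unit, inferInstance, fun _ => A n, (Set.iUnion_const _).ge, fun _ => by simpa using hdiam n, ?_⟩
      simpa using ENNReal.rpow_le_rpow (hdiam n) s.coe_nonneg
    | succ k ih =>
      intro n
      have h := HasCover.of_subset_iUnion_similarity s.coe_nonneg (hr0 n) (hr n) (hsum n) (hA n)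
        (ih (n + 1))
      rwa [pow_succ, div_eq_mul_inv, ENNReal.mul_inv (by simp) (by simp), ← mul_assoc]
  choose ι' hι' U hU hδ hc using fun k => key k n
  have hlim : Tendsto (fun k : ℕ => b / 2 ^ k) atTop (𝓝 0) := by
    have h := ENNReal.Tendsto.const_mul (a := b)
      (ENNReal.tendsto_pow_atTop_nhds_zero_of_lt_one (r := 2⁻¹) (by simp)) (Or.inr hb)
    simpa [div_eq_mul_inv, ENNReal.inv_pow] using h
  have hle := MeasureTheory.Measure.hausdorffMeasure_le_liminf_tsum (s : ℝ) (A n) (l := atTop) _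
    hlim U (Eventually.of_forall hδ) (Eventually.of_forall hU)
  refine dimH_le_of_hausdorffMeasure_ne_top (ne_top_of_le_ne_top
    (ENNReal.rpow_ne_top_of_nonneg s.coe_nonneg hb) (hle.trans ?_))
  exact liminf_le_of_le (by isBoundedDefault) fun c h => by
    obtain ⟨k, hk⟩ := h.exists
    exact hk.trans (hc k)

/-! ### Compact sets with empty interior and prescribed dimension -/

/-- The sum of the series `∑ aₙ lⁿ⁺¹` with binary digits `aₙ`. -/
noncomputable def digitSum (l : ℝ) (a : ℕ → Fin 2) : ℝ := ∑' n, ((a n : ℕ) : ℝ) * l ^ (n + 1)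

section digitSum

variable {l : ℝ}

theorem digitSum_term_le (hl0 : 0 ≤ l) (a : ℕ → Fin 2) (n : ℕ) :
    ((a n : ℕ) : ℝ) * l ^ (n + 1) ≤ l * l ^ n := by
  have h : ((a n : ℕ) : ℝ) ≤ 1 := by exact_mod_cast Nat.le_of_lt_succ (a n).isLt
  calc ((a n : ℕ) : ℝ) * l ^ (n + 1) ≤ 1 * l ^ (n + 1) := by gcongr
    _ = l * l ^ n := by ring

theorem summable_digitSum (hl0 : 0 ≤ l) (hl1 : l < 1) (a : ℕ → Fin 2) :
    Summable fun n => ((a n : ℕ) : ℝ) * l ^ (n + 1) :=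
  Summable.of_nonneg_of_le (fun n => by positivity) (digitSum_term_le hl0 a)
    ((summable_geometric_of_lt_one hl0 hl1).mul_left l)

theorem digitSum_nonneg (hl0 : 0 ≤ l) (a : ℕ → Fin 2) : 0 ≤ digitSum l a :=
  tsum_nonneg fun n => by positivity

theorem digitSum_le (hl0 : 0 ≤ l) (hl1 : l < 1) (a : ℕ → Fin 2) :
    digitSum l a ≤ l / (1 - l) := by
  refine (Summable.tsum_le_tsum (digitSum_term_le hl0 a) (summable_digitSum hl0 hl1 a)
    ((summable_geometric_of_lt_one hl0 hl1).mul_left l)).trans_eq ?_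
  rw [tsum_mul_left, tsum_geometric_of_lt_one hl0 hl1, div_eq_mul_inv]

theorem digitSum_shift (hl0 : 0 ≤ l) (hl1 : l < 1) (a : ℕ → Fin 2) :
    digitSum l a = l * (a 0 : ℕ) + l * digitSum l fun n => a (n + 1) := by
  rw [digitSum, (summable_digitSum hl0 hl1 a).tsum_eq_zero_add, digitSum, ← tsum_mul_left]
  congr 1
  · ring
  · exact tsum_congr fun n => by ring

theorem continuous_digitSum (hl0 : 0 ≤ l) (hl1 : l < 1) : Continuous (digitSum l) := by
  refine continuous_tsum (fun n => ?_) ((summable_geometric_of_lt_one hl0 hl1).mul_left l)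
    fun n a => ?_
  · exact (continuous_of_discreteTopology (f := fun x : Fin 2 => ((x : ℕ) : ℝ))).comp
      (continuous_apply n) |>.mul continuous_const
  · rw [Real.norm_of_nonneg (by positivity)]
    exact digitSum_term_le hl0 a n

/-- The first differing digit contributes `l ^ (n + 1)`, and the tails can cancel at most the
fraction `l / (1 - l)` of it. -/
theorem le_abs_digitSum_sub (hl0 : 0 ≤ l) (hl1 : l < 1) (n : ℕ) (a b : ℕ → Fin 2)
    (hab : ∀ i < n, a i = b i) (hn : a n ≠ b n) :
    l ^ (n + 1) * ((1 - 2 * l) / (1 - l)) ≤ |digitSum l a - digitSum l b| := by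
  induction n generalizing a b with
  | zero =>
    have hl : (1 - l) ≠ 0 := by linarith
    have ha0 := digitSum_nonneg hl0 fun n => a (n + 1)
    have hb0 := digitSum_nonneg hl0 fun n => b (n + 1)
    have ha1 := mul_le_mul_of_nonneg_left (digitSum_le hl0 hl1 fun n => a (n + 1)) hl0
    have hb1 := mul_le_mul_of_nonneg_left (digitSum_le hl0 hl1 fun n => b (n + 1)) hl0
    have ha2 := mul_nonneg hl0 ha0
    have hb2 := mul_nonneg hl0 hb0
    have e : l ^ (0 + 1) * ((1 - 2 * l) / (1 - l)) = l - l * (l / (1 - l)) := by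
      field_simp
      ring
    rw [e, digitSum_shift hl0 hl1 a, digitSum_shift hl0 hl1 b]
    obtain h | h : (a 0 = 0 ∧ b 0 = 1) ∨ (a 0 = 1 ∧ b 0 = 0) := by
      generalize a 0 = x at hn
      generalize b 0 = y at hn
      revert x y
      decide
    · rw [abs_sub_comm, h.1, h.2]
      refine le_trans ?_ (le_abs_self _)
      simp
      linarith
    · rw [h.1, h.2]
      refine le_trans ?_ (le_abs_self _)
      simp
      linarith
  | succ n ih =>
    have h := ih (fun n => a (n + 1)) (fun n => b (n + 1)) (fun i hi => hab _ (by omega)) hn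
    rw [digitSum_shift hl0 hl1 a, digitSum_shift hl0 hl1 b, hab 0 (by omega), add_sub_add_left_eq_sub,
      ← mul_sub, abs_mul, abs_of_nonneg hl0]
    calc l ^ (n + 1 + 1) * ((1 - 2 * l) / (1 - l))
        = l * (l ^ (n + 1) * ((1 - 2 * l) / (1 - l))) := by ring
      _ ≤ _ := by gcongr

end digitSum

/-- The point of `ℝᵈ` whose coordinates have the base `l⁻¹` digits `a`. -/
noncomputable def cantorPoint {d : ℕ} (l : ℝ) (a : Fin d → ℕ → Fin 2) :
    EuclideanSpace ℝ (Fin d) :=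
  WithLp.toLp 2 fun i => digitSum l (a i)

theorem isCompact_range_cantorPoint (d : ℕ) {l : ℝ} (hl0 : 0 ≤ l) (hl1 : l < 1) :
    IsCompact (Set.range (cantorPoint (d := d) l)) := by
  refine isCompact_range ((PiLp.continuous_toLp 2 _).comp (continuous_pi fun i => ?_))
  exact (continuous_digitSum hl0 hl1).comp (continuous_apply i)

theorem dimH_range_cantorPoint_le (d : ℕ) {l : ℝ} (hl0 : 0 < l) (hl1 : l < 1 / 2) {s : NNReal}
    (hs : l ^ (s : ℝ) * 2 ^ d ≤ 1) : dimH (Set.range (cantorPoint (d := d) l)) ≤ s := by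
  have hb := (isCompact_range_cantorPoint d hl0.le (by linarith)).isBounded.ediam_ne_top
  refine dimH_le_of_subset_iUnion_similarity (ι := Fin d → Fin 2) hb
    (fun x => WithLp.toLp 2 fun i => l * (x i : ℕ)) (fun _ _ => l) (fun _ => _)
    (fun _ _ => hl0.le) (fun _ _ => hl1.le) (fun _ => ?_) (fun _ => ?_) (fun _ => le_rfl) 0
  · rw [tsum_fintype, Finset.sum_const, nsmul_eq_mul, ENNReal.ofReal_rpow_of_pos hl0]
    simp only [Finset.card_univ, Fintype.card_pi, Fintype.card_fin, Finset.prod_const]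
    rw [← ENNReal.ofReal_natCast, ← ENNReal.ofReal_mul (by positivity), ← ENNReal.ofReal_one]
    exact ENNReal.ofReal_le_ofReal (by push_cast; linarith)
  · rintro _ ⟨a, rfl⟩
    refine Set.mem_iUnion.2 ⟨fun i => a i 0, cantorPoint l (fun i n => a i (n + 1)), ⟨_, rfl⟩, ?_⟩
    ext i
    simp [similarity, cantorPoint, digitSum_shift hl0.le (by linarith : l < 1) (a i)]

/-- Rereading Cantor digits in base `2` is `α`-Hölder: if the first difference is at place `n`, the
images are within `2⁻ⁿ`, while the points are at least a constant times `l ^ (n + 1)` apart, and `(l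
^ (n + 1)) ^ α = 2⁻ⁿ⁻¹`. -/
theorem dist_ofDigits_le_of_cantorPoint {d : ℕ} {l α : ℝ} (hl0 : 0 < l) (hl1 : l < 1 / 2)
    (hα0 : 0 < α) (hα : l ^ α = 1 / 2) (a b : Fin d → ℕ → Fin 2) :
    dist (fun i => Real.ofDigits (a i)) (fun i => Real.ofDigits (b i)) ≤
      2 * ((1 - l) / (1 - 2 * l)) ^ α * dist (cantorPoint l a) (cantorPoint l b) ^ α := by
  by_cases hab : a = b
  · subst hab
    simp [Real.zero_rpow hα0.ne']
  have hex : ∃ n, ∃ i, a i n ≠ b i n := by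
    by_contra! h
    exact hab (funext fun i => funext fun n => h n i)
  classical
  obtain ⟨n, ⟨i, hi⟩, hmin⟩ : ∃ n, (∃ i, a i n ≠ b i n) ∧ ∀ m < n, ∀ i, a i m = b i m :=
    ⟨Nat.find hex, Nat.find_spec hex, fun m hm => by simpa using Nat.find_min hex hm⟩
  have h1 : dist (fun i => Real.ofDigits (a i)) (fun i => Real.ofDigits (b i)) ≤
      (1 / 2) ^ n := by
    refine (dist_pi_le_iff (by positivity)).2 fun j => ?_
    have h := Real.abs_ofDigits_sub_ofDigits_le (b := 2) (n := n) (x := a j) (y := b j)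
      (fun m hm => hmin m hm j)
    simpa [Real.dist_eq] using h
  have h2 := le_abs_digitSum_sub hl0.le (by linarith) n (a i) (b i) (fun m hm => hmin m hm i) hi
  have h3 : |digitSum l (a i) - digitSum l (b i)| ≤ dist (cantorPoint l a) (cantorPoint l b) := by
    rw [dist_eq_norm]
    simpa [cantorPoint] using PiLp.norm_apply_le (cantorPoint l a - cantorPoint l b) i
  have hl2 : 0 < 1 - 2 * l := by linarith
  have hl3 : 0 < 1 - l := by linarith
  have h4 : l ^ (n + 1) ≤ (1 - l) / (1 - 2 * l) * dist (cantorPoint l a) (cantorPoint l b) := by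
    have h := h2.trans h3
    rw [div_mul_eq_mul_div, le_div_iff₀ hl2]
    rw [mul_div_assoc', div_le_iff₀ hl3] at h
    linarith
  have h5 := Real.rpow_le_rpow (by positivity) h4 hα0.le
  rw [Real.mul_rpow (by positivity) dist_nonneg, ← Real.rpow_natCast, ← Real.rpow_mul hl0.le,
    mul_comm _ α, Real.rpow_mul hl0.le, hα, Real.rpow_natCast] at h5
  calc _ ≤ (1 / 2) ^ n := h1
    _ = 2 * (1 / 2 : ℝ) ^ (n + 1) := by ring
    _ ≤ _ := by linarith

/-- The Hölder map of the previous lemma sends the Cantor set onto a set containing the unit cube,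
and an `α`-Hölder map raises dimension by at most the factor `1 / α`. -/
theorem le_dimH_range_cantorPoint (d : ℕ) {l : ℝ} {α : NNReal} (hl0 : 0 < l) (hl1 : l < 1 / 2)
    (hα0 : 0 < α) (hα : l ^ (α : ℝ) = 1 / 2) :
    α * d ≤ dimH (Set.range (cantorPoint (d := d) l)) := by
  set f : EuclideanSpace ℝ (Fin d) → Fin d → ℝ :=
    fun x i => Real.ofDigits (Function.invFun (cantorPoint l) x i) with hf
  have hinv : ∀ x ∈ Set.range (cantorPoint (d := d) l),
      cantorPoint l (Function.invFun (cantorPoint l) x) = x := fun x hx => Function.invFun_eq hx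
  set c : ℝ := 2 * ((1 - l) / (1 - 2 * l)) ^ (α : ℝ) with hc
  have hc0 : 0 ≤ c := by
    have hl2 : 0 < 1 - 2 * l := by linarith
    have hl3 : 0 < 1 - l := by linarith
    positivity
  have hold : HolderOnWith c.toNNReal α f (Set.range (cantorPoint (d := d) l)) := by
    intro x hx y hy
    have h := dist_ofDigits_le_of_cantorPoint hl0 hl1 (NNReal.coe_pos.2 hα0) hα
      (Function.invFun (cantorPoint l) x) (Function.invFun (cantorPoint l) y)
    rw [hinv x hx, hinv y hy] at h
    rw [edist_dist, edist_dist, ENNReal.ofReal_rpow_of_nonneg dist_nonneg α.coe_nonneg]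
    change _ ≤ ENNReal.ofReal c * _
    rw [← ENNReal.ofReal_mul hc0]
    exact ENNReal.ofReal_le_ofReal h
  have hinj : Function.Injective (cantorPoint (d := d) l) := by
    intro a b hab
    by_contra hne
    obtain ⟨i, hi⟩ := Function.ne_iff.1 hne
    have hex := Function.ne_iff.1 hi
    classical
    have h := le_abs_digitSum_sub hl0.le (by linarith) (Nat.find hex) (a i) (b i)
      (fun m hm => by simpa using Nat.find_min hex hm) (Nat.find_spec hex)
    have e : digitSum l (a i) = digitSum l (b i) :=
      congrArg (fun x : EuclideanSpace ℝ (Fin d) => x i) hab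
    rw [e, sub_self, abs_zero] at h
    have hl2 : 0 < 1 - 2 * l := by linarith
    have hl3 : 0 < 1 - l := by linarith
    have : 0 < l ^ (Nat.find hex + 1) * ((1 - 2 * l) / (1 - l)) := by positivity
    linarith
  have hsub : Set.Icc (0 : Fin d → ℝ) 1 ⊆ f '' Set.range (cantorPoint (d := d) l) := by
    intro y hy
    choose a _ ha using fun i => Real.ofDigits_SurjOn (b := 2) one_lt_two ⟨hy.1 i, hy.2 i⟩
    refine ⟨cantorPoint l a, ⟨a, rfl⟩, funext fun i => ?_⟩
    simp only [hf]
    rw [Function.leftInverse_invFun hinj a, ha]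
  have hint : (interior (Set.Icc (0 : Fin d → ℝ) 1)).Nonempty := by
    rw [← Set.pi_univ_Icc, interior_pi_set Set.finite_univ]
    exact ⟨fun _ => 1 / 2, fun i _ => by simp [interior_Icc]; norm_num⟩
  have h1 := (dimH_mono hsub).trans (hold.dimH_image_le hα0)
  rw [Real.dimH_of_nonempty_interior hint] at h1
  rw [ENNReal.le_div_iff_mul_le (by simp [hα0.ne']) (by simp)] at h1
  simpa [mul_comm] using h1

theorem exists_isCompact_dimH_eq_of_lt (d : ℕ) {s : NNReal} (hs0 : 0 < s) (hsd : s < d) :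
    ∃ C : Set (EuclideanSpace ℝ (Fin d)), IsCompact C ∧ C.Nonempty ∧ dimH C = s := by
  have hs0' : (0 : ℝ) < s := hs0
  have hsd' : (s : ℝ) < d := by exact_mod_cast hsd
  have hd : (0 : ℝ) < d := hs0'.trans hsd'
  -- This ratio solves `2 ^ d * l ^ s = 1`, the dimension equation for `2 ^ d` copies; equivalently
  -- `l ^ (s / d) = 1 / 2`.
  set l : ℝ := 2⁻¹ ^ ((d : ℝ) / s) with hl
  have hl0 : 0 < l := by positivity
  have hl1 : l < 1 / 2 := by
    have h := Real.rpow_lt_rpow_of_exponent_gt (x := (2⁻¹ : ℝ)) (by norm_num) (by norm_num)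
      ((one_lt_div hs0').2 hsd')
    rw [Real.rpow_one] at h
    linarith
  refine ⟨_, isCompact_range_cantorPoint d hl0.le (by linarith), Set.range_nonempty _,
    le_antisymm (dimH_range_cantorPoint_le d hl0 hl1 ?_) ?_⟩
  · rw [hl, ← Real.rpow_mul (by norm_num), div_mul_cancel₀ _ hs0'.ne', Real.rpow_natCast,
      ← mul_pow]
    norm_num
  · have h := le_dimH_range_cantorPoint d (α := s / d) hl0 hl1
      (div_pos hs0 (by exact_mod_cast hd)) (by
        rw [hl, ← Real.rpow_mul (by norm_num), NNReal.coe_div, NNReal.coe_natCast,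
          div_mul_div_cancel₀ hs0'.ne', div_self hd.ne', Real.rpow_one]
        norm_num)
    have e : ((s / d : NNReal) : ENNReal) * d = s := by
      rw [← ENNReal.coe_natCast, ← ENNReal.coe_mul, div_mul_cancel₀ _ (by exact_mod_cast hd.ne')]
    rwa [e] at h

-- A Cantor set of ratio below `1 / 2` cannot reach dimension `d`. Instead, remove from the unit
-- ball an open dense set of smaller measure: what remains has positive measure and empty interior.
open MeasureTheory in
theorem exists_isCompact_dimH_eq_finrank (d : ℕ) [NeZero d] :
    ∃ C : Set (EuclideanSpace ℝ (Fin d)),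
      IsCompact C ∧ C.Nonempty ∧ interior C = ∅ ∧ dimH C = d := by
  let V := EuclideanSpace ℝ (Fin d)
  have hfr : Module.finrank ℝ V = d := finrank_euclideanSpace_fin
  let μ : Measure V := μH[Module.finrank ℝ V]
  have : Nontrivial V := Module.nontrivial_of_finrank_pos (R := ℝ) (by
    rw [hfr]
    exact Nat.pos_of_ne_zero (NeZero.ne d))
  obtain ⟨D, hDc, hDd⟩ := TopologicalSpace.exists_countable_dense V
  have hball : 0 < μ (Metric.closedBall 0 1) := Metric.measure_closedBall_pos μ 0 one_pos
  obtain ⟨U, hDU, hU, hμU⟩ := Set.exists_isOpen_lt_of_lt (μ := μ) D (μ (Metric.closedBall 0 1))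
    (by rwa [hDc.measure_zero μ])
  have hpos : μ (Metric.closedBall 0 1 \ U) ≠ 0 := fun h => by
    have h1 : μ (Metric.closedBall 0 1) ≤ μ (Metric.closedBall 0 1 \ U) + μ U :=
      (measure_mono (by rw [Set.sdiff_union_self]; exact Set.subset_union_left)).trans
        (measure_union_le _ _)
    rw [h, zero_add] at h1
    exact absurd hμU h1.not_gt
  refine ⟨Metric.closedBall 0 1 \ U, (isCompact_closedBall 0 1).diff hU,
    nonempty_of_measure_ne_zero hpos, ?_, le_antisymm ?_ ?_⟩
  · have h : Dense U := hDd.mono hDU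
    rw [Set.sdiff_eq, interior_inter, h.interior_compl, Set.inter_empty]
  · calc dimH (Metric.closedBall (0 : V) 1 \ U) ≤ dimH (Set.univ : Set V) :=
          dimH_mono (Set.subset_univ _)
      _ = d := by rw [Real.dimH_univ_eq_finrank, hfr]
  · have h := le_dimH_of_hausdorffMeasure_ne_zero (d := (d : NNReal))
      (s := Metric.closedBall (0 : V) 1 \ U) (by
        have h := hpos
        simp only [μ, hfr] at h
        simpa using h)
    simpa using h

/-- Compact sets with empty interior and prescribed dimension, inside any small ball. -/
theorem exists_isCompact_subset_closedBall_dimH_eq (d : ℕ) [NeZero d] {s : ℝ}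
    (hs : s ∈ Set.Icc (0 : ℝ) d) {ε : ℝ} (hε : 0 < ε) :
    ∃ C : Set (EuclideanSpace ℝ (Fin d)), IsCompact C ∧ C.Nonempty ∧ interior C = ∅ ∧
      C ⊆ Metric.closedBall 0 ε ∧ dimH C = ENNReal.ofReal s := by
  obtain ⟨C, hC, hne, hint, hdim⟩ : ∃ C : Set (EuclideanSpace ℝ (Fin d)), IsCompact C ∧
      C.Nonempty ∧ interior C = ∅ ∧ dimH C = ENNReal.ofReal s := by
    rcases hs.2.eq_or_lt with rfl | hsd
    · simpa using exists_isCompact_dimH_eq_finrank d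
    -- Below dimension `d` the empty interior is automatic.
    have hint : ∀ C : Set (EuclideanSpace ℝ (Fin d)), dimH C = ENNReal.ofReal s →
        interior C = ∅ := fun C hC => by
      by_contra h
      have h := Real.dimH_of_nonempty_interior (Set.nonempty_iff_ne_empty.2 h)
      rw [hC, finrank_euclideanSpace_fin, ← ENNReal.ofReal_natCast,
        ENNReal.ofReal_eq_ofReal_iff hs.1 (by positivity)] at h
      exact hsd.ne h
    rcases hs.1.eq_or_lt with rfl | hs0
    · have h0 : dimH ({0} : Set (EuclideanSpace ℝ (Fin d))) = ENNReal.ofReal 0 := by simp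
      exact ⟨{0}, isCompact_singleton, Set.singleton_nonempty _, hint _ h0, h0⟩
    · obtain ⟨C, hC, hne, hdim⟩ := exists_isCompact_dimH_eq_of_lt d (s := s.toNNReal)
        (Real.toNNReal_pos.2 hs0) ((Real.toNNReal_lt_natCast (NeZero.ne d)).2 hsd)
      exact ⟨C, hC, hne, hint C hdim, hdim⟩
  obtain ⟨R, hR, hCR⟩ := hC.isBounded.exists_pos_norm_le
  have hc : ε / R ≠ 0 := (div_pos hε hR).ne'
  let e := ContinuousLinearEquiv.smulLeft (R₁ := ℝ) (M₁ := EuclideanSpace ℝ (Fin d))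
    (Units.mk0 (ε / R) hc)
  refine ⟨e '' C, hC.image e.continuous, hne.image _, ?_, ?_, ?_⟩
  · have h := e.toHomeomorph.image_interior C
    rw [hint, Set.image_empty] at h
    exact h.symm
  · rintro _ ⟨x, hx, rfl⟩
    have h : e x = (ε / R) • x := rfl
    rw [mem_closedBall_zero_iff, h, norm_smul, Real.norm_of_nonneg (by positivity)]
    calc ε / R * ‖x‖ ≤ ε / R * R := by gcongr; exact hCR x hx
      _ = ε := div_mul_cancel₀ _ hR.ne'
  · rw [e.dimH_image, hdim]

/-! ### Attaching small copies to a compact set -/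

section attach

variable {V : Type*} [NormedAddCommGroup V] [NormedSpace ℝ V]

/-- The set `C` together with a copy of `Y`, scaled by `r q`, attached at each point `q ∈ P`. -/
def attach (C P : Set V) (r : V → ℝ) (Y : Set V) : Set V :=
  C ∪ ⋃ q ∈ P, similarity q (r q) '' Y

/-- The points of `P` accumulate only at `C`, and balls of radius `r q * B` around the points
`q ∈ P` are well separated from each other and from `C`. -/
structure IsSeparated (C P : Set V) (B : ℝ) (r : V → ℝ) : Prop where
  finite : ∀ ε > 0, {q ∈ P | ε ≤ Metric.infDist q C}.Finite
  pos : ∀ q ∈ P, 0 < r q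
  le_dist : ∀ q ∈ P, ∀ q' ∈ P, q ≠ q' → 4 * (r q * B) ≤ dist q q'
  le_infDist : ∀ q ∈ P, 4 * (r q * B) ≤ Metric.infDist q C

variable {C P Y : Set V} {B : ℝ} {r : V → ℝ}

theorem mem_attach {x : V} : x ∈ attach C P r Y ↔ x ∈ C ∨ ∃ q ∈ P, ∃ y ∈ Y,
    similarity q (r q) y = x := by
  simp [attach]

theorem similarity_mem_closedBall {q y : V} {a : ℝ} (ha : 0 ≤ a)
    (hy : y ∈ Metric.closedBall 0 B) : similarity q a y ∈ Metric.closedBall q (a * B) := by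
  rw [mem_closedBall_zero_iff] at hy
  rw [mem_closedBall_iff_norm, similarity, add_sub_cancel_left, norm_smul, Real.norm_of_nonneg ha]
  gcongr

/-- Near `q` only the copy at `q` is visible, so local properties of `Y` pass to the union. -/
theorem IsSeparated.attach_inter_ball (h : IsSeparated C P B r) (hB : 0 < B)
    (hY : Y ⊆ Metric.closedBall 0 B) {q : V} (hq : q ∈ P) :
    attach C P r Y ∩ Metric.ball q (2 * (r q * B)) =
      similarity q (r q) '' Y ∩ Metric.ball q (2 * (r q * B)) := by
  have hpos := mul_pos (h.pos q hq) hB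
  ext x
  constructor
  · rintro ⟨hx, hxq⟩
    refine ⟨?_, hxq⟩
    rw [Metric.mem_ball] at hxq
    rcases mem_attach.1 hx with hx | ⟨q', hq', y, hy, rfl⟩
    · have h1 := h.le_infDist q hq
      have h2 := Metric.infDist_le_dist_of_mem (x := q) hx
      rw [dist_comm] at h2
      linarith
    · by_cases hne : q = q'
      · subst hne
        exact ⟨y, hy, rfl⟩
      · have h1 := h.le_dist q hq q' hq' hne
        have h2 := h.le_dist q' hq' q hq (Ne.symm hne)
        have h3 := Metric.mem_closedBall.1 (similarity_mem_closedBall (h.pos q' hq').le (hY hy)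
          (q := q'))
        have h4 := dist_triangle_left q q' (similarity q' (r q') y)
        rw [dist_comm q' q] at h2
        linarith
  · rintro ⟨⟨y, hy, rfl⟩, hxq⟩
    exact ⟨mem_attach.2 (Or.inr ⟨q, hq, y, hy, rfl⟩), hxq⟩

theorem IsSeparated.attach_inter_ball_similarity (h : IsSeparated C P B r) (hB : 0 < B)
    (hY : Y ⊆ Metric.closedBall 0 B) {q y : V} (hq : q ∈ P) (hy : y ∈ Y) :
    attach C P r Y ∩ Metric.ball (similarity q (r q) y) (r q * B) =
      similarity q (r q) '' Y ∩ Metric.ball (similarity q (r q) y) (r q * B) := by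
  have hsub : Metric.ball (similarity q (r q) y) (r q * B) ⊆ Metric.ball q (2 * (r q * B)) := by
    refine Metric.ball_subset_ball' ?_
    have := Metric.mem_closedBall.1 (similarity_mem_closedBall (h.pos q hq).le (hY hy) (q := q))
    linarith
  have h1 := h.attach_inter_ball hB hY hq
  rw [← Set.inter_eq_self_of_subset_right hsub, ← Set.inter_assoc, h1, Set.inter_assoc]

/-- Outside any neighbourhood of `C` only finitely many copies matter, since the copies are small
compared with their distance from `C`. A limit point off `C` therefore lies in one of finitely many
compact copies. -/
theorem IsSeparated.isCompact_attach [FiniteDimensional ℝ V] (h : IsSeparated C P B r)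
    (hC : IsCompact C) (hne : C.Nonempty) (hYc : IsCompact Y)
    (hY : Y ⊆ Metric.closedBall 0 B) : IsCompact (attach C P r Y) := by
  have hcover : ∀ ε > 0, attach C P r Y ⊆ Metric.cthickening (2 * ε) C ∪
      ⋃ q ∈ {q ∈ P | ε ≤ Metric.infDist q C}, similarity q (r q) '' Y := by
    intro ε hε x hx
    rcases mem_attach.1 hx with hx | ⟨q, hq, y, hy, rfl⟩
    · exact Or.inl (Metric.self_subset_cthickening C hx)
    · rcases le_or_gt ε (Metric.infDist q C) with hqε | hqε
      · exact Or.inr (Set.mem_biUnion (x := q) ⟨hq, hqε⟩ ⟨y, hy, rfl⟩)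
      · refine Or.inl ?_
        rw [hC.isClosed.cthickening_eq_biUnion_closedBall (by linarith)]
        obtain ⟨z, hz, hzq⟩ := (Metric.infDist_lt_iff hne).1 hqε
        refine Set.mem_biUnion hz (Metric.mem_closedBall.2 ?_)
        have h1 := h.le_infDist q hq
        have h2 := Metric.mem_closedBall.1
          (similarity_mem_closedBall (h.pos q hq).le (hY hy) (q := q))
        have h3 := dist_triangle (similarity q (r q) y) q z
        linarith
  have hcopy : ∀ q, IsCompact (similarity q (r q) '' Y) := fun q =>
    hYc.image (lipschitzWith_similarity q (r q)).continuous
  have hK : ∀ ε > 0, IsCompact (Metric.cthickening (2 * ε) C ∪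
      ⋃ q ∈ {q ∈ P | ε ≤ Metric.infDist q C}, similarity q (r q) '' Y) := fun ε hε =>
    hC.cthickening.union ((h.finite ε hε).isCompact_biUnion fun q _ => hcopy q)
  refine (hK 1 one_pos).of_isClosed_subset ?_ (hcover 1 one_pos)
  refine isClosed_of_closure_subset fun x hx => ?_
  by_cases hxC : x ∈ C
  · exact Or.inl hxC
  have hpos := (hC.isClosed.notMem_iff_infDist_pos hne).1 hxC
  have hx' := closure_minimal (hcover _ (div_pos hpos four_pos)) (hK _ (div_pos hpos four_pos)).isClosed hx
  rcases hx' with hx' | hx'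
  · rw [hC.isClosed.cthickening_eq_biUnion_closedBall (by linarith)] at hx'
    obtain ⟨z, hz, hzx⟩ := Set.mem_iUnion₂.1 hx'
    have := Metric.infDist_le_dist_of_mem (x := x) hz
    rw [Metric.mem_closedBall] at hzx
    linarith
  · obtain ⟨q, hq, y, hy, rfl⟩ := Set.mem_iUnion₂.1 hx'
    exact mem_attach.2 (Or.inr ⟨q, hq.1, y, hy, rfl⟩)

omit [NormedSpace ℝ V] in
theorem countable_of_finite_infDist (hC : IsClosed C) (hne : C.Nonempty) (hd : Disjoint C P)
    (hfin : ∀ ε > 0, {q ∈ P | ε ≤ Metric.infDist q C}.Finite) : P.Countable := by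
  have h : P ⊆ ⋃ n : ℕ, {q ∈ P | 1 / ((n : ℝ) + 1) ≤ Metric.infDist q C} := fun q hq => by
    obtain ⟨n, hn⟩ := exists_nat_one_div_lt
      ((hC.notMem_iff_infDist_pos hne).1 (hd.notMem_of_mem_right hq))
    exact Set.mem_iUnion.2 ⟨n, hq, hn.le⟩
  exact (Set.countable_iUnion fun n : ℕ => (hfin _ Nat.one_div_pos_of_nat).countable).mono h

theorem dimH_attach_le (hP : P.Countable) :
    dimH (attach C P r Y) ≤ max (dimH C) (dimH Y) := by
  rw [attach, dimH_union, dimH_bUnion hP]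
  exact max_le_max le_rfl (iSup₂_le fun q _ => (lipschitzWith_similarity q (r q)).dimH_image_le Y)

omit [NormedSpace ℝ V] in
/-- All sufficiently small ratios separate a set `P` that accumulates only at `C`. -/
theorem exists_forall_isSeparated (hB : 0 < B) (hC : IsClosed C) (hne : C.Nonempty)
    (hd : Disjoint C P) (hfin : ∀ ε > 0, {q ∈ P | ε ≤ Metric.infDist q C}.Finite) :
    ∃ ρ : V → ℝ, (∀ q ∈ P, 0 < ρ q) ∧
      ∀ r : V → ℝ, (∀ q ∈ P, 0 < r q ∧ r q ≤ ρ q) → IsSeparated C P B r := by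
  have key : ∀ q : V, ∃ δ : ℝ, q ∈ P → 0 < δ ∧ δ ≤ Metric.infDist q C ∧
      ∀ q' ∈ P, q ≠ q' → δ ≤ dist q q' := by
    intro q
    by_cases hq : q ∈ P
    swap
    · exact ⟨0, fun h => absurd h hq⟩
    have hpos := (hC.notMem_iff_infDist_pos hne).1 (hd.notMem_of_mem_right hq)
    have hS := (hfin _ (half_pos hpos)).subset (Set.sdiff_subset (t := {q}))
    obtain ⟨δ, hδ, hδS⟩ := Metric.isOpen_iff.1 hS.isClosed.isOpen_compl q (by simp)
    refine ⟨min δ (Metric.infDist q C / 2), fun _ => ⟨lt_min hδ (half_pos hpos),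
      (min_le_right _ _).trans (by linarith), fun q' hq' hqq' => ?_⟩⟩
    -- Finitely many points are at least half as far from `C` as `q`; any other point is far from
    -- `q` because `infDist` is 1-Lipschitz.
    by_cases hq'' : Metric.infDist q C / 2 ≤ Metric.infDist q' C
    · refine (min_le_left _ _).trans (not_lt.1 fun hlt => ?_)
      rw [dist_comm] at hlt
      exact hδS hlt ⟨⟨hq', hq''⟩, Ne.symm hqq'⟩
    · refine (min_le_right _ _).trans ?_
      have := Metric.infDist_le_infDist_add_dist (s := C) (x := q) (y := q')
      linarith
  choose δ hδ using key
  refine ⟨fun q => δ q / (4 * B), fun q hq => div_pos (hδ q hq).1 (by linarith),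
    fun r hr => ?_⟩
  have h4 : ∀ q ∈ P, 4 * (r q * B) ≤ δ q := fun q hq => by
    have := (le_div_iff₀ (by linarith)).1 (hr q hq).2
    linarith
  exact ⟨hfin, fun q hq => (hr q hq).1, fun q hq q' hq' hne => (h4 q hq).trans
    ((hδ q hq).2.2 q' hq' hne), fun q hq => (h4 q hq).trans (hδ q hq).2.1⟩

end attach

/-! ### Locality, invariance and a criterion for tangent sets -/

section tangent

variable {d : ℕ}

theorem norm_le_of_mem_cubeQ {x : EuclideanSpace ℝ (Fin d)} (hx : x ∈ cubeQ d) : ‖x‖ ≤ d := by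
  rw [EuclideanSpace.norm_eq, Real.sqrt_le_left (by positivity)]
  calc ∑ i, ‖x i‖ ^ 2 ≤ ∑ _i : Fin d, (1 : ℝ) := by
        gcongr with i
        rw [sq_le_one_iff₀ (norm_nonneg _)]
        exact abs_le.2 (hx i)
    _ = d := by simp
    _ ≤ (d : ℝ) ^ 2 := by exact_mod_cast Nat.le_self_pow two_ne_zero d

theorem closedBall_subset_cubeQ : Metric.closedBall (0 : EuclideanSpace ℝ (Fin d)) 1 ⊆ cubeQ d :=
  fun x hx i => abs_le.1 ((PiLp.norm_apply_le x i).trans (mem_closedBall_zero_iff.1 hx))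

/-- The cube lies in the ball of radius `d` (a crude form of `√d`), so the window at scale `t` sees
only points within `t * d` of `x`. -/
theorem zoom_congr_of_inter_ball {x : EuclideanSpace ℝ (Fin d)}
    {X Y : Set (EuclideanSpace ℝ (Fin d))} {η t : ℝ} (ht : 0 < t) (htη : t * d < η)
    (h : X ∩ Metric.ball x η = Y ∩ Metric.ball x η) : zoom x t X = zoom x t Y := by
  have key : ∀ X Y : Set (EuclideanSpace ℝ (Fin d)),
      X ∩ Metric.ball x η = Y ∩ Metric.ball x η → zoom x t X ⊆ zoom x t Y := by
    rintro X Y h _ ⟨⟨y, hy, rfl⟩, hQ⟩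
    have hn := norm_le_of_mem_cubeQ hQ
    simp only [norm_smul, norm_inv, Real.norm_of_nonneg ht.le] at hn
    rw [inv_mul_le_iff₀ ht] at hn
    have hmem : y ∈ Y ∩ Metric.ball x η :=
      h ▸ ⟨hy, by rw [mem_ball_iff_norm]; exact hn.trans_lt htη⟩
    exact ⟨⟨y, hmem.1, rfl⟩, hQ⟩
  exact (key X Y h).antisymm (key Y X h.symm)

theorem tangentSets_congr_of_inter_ball {x : EuclideanSpace ℝ (Fin d)}
    {X Y : Set (EuclideanSpace ℝ (Fin d))} {η : ℝ} (hη : 0 < η)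
    (h : X ∩ Metric.ball x η = Y ∩ Metric.ball x η) : tangentSets X x = tangentSets Y x := by
  have key : ∀ X Y : Set (EuclideanSpace ℝ (Fin d)),
      X ∩ Metric.ball x η = Y ∩ Metric.ball x η → tangentSets X x ⊆ tangentSets Y x := by
    rintro X Y h F ⟨hF, t, ht, hanti, hlim, hconv⟩
    refine ⟨hF, t, ht, hanti, hlim, hconv.congr' ?_⟩
    have hlim' : Tendsto (fun n => t n * d) atTop (𝓝 0) := by simpa using hlim.mul_const (d : ℝ)
    filter_upwards [hlim'.eventually_lt_const hη] with n hn
    rw [zoom_congr_of_inter_ball (ht n) hn h]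
  exact (key X Y h).antisymm (key Y X h.symm)

theorem zoom_similarity (q x : EuclideanSpace ℝ (Fin d)) {r : ℝ} (hr : 0 < r) (t : ℝ)
    (Y : Set (EuclideanSpace ℝ (Fin d))) :
    zoom (similarity q r x) (r * t) (similarity q r '' Y) = zoom x t Y := by
  rw [zoom, zoom, Set.image_image]
  congr 1
  refine Set.image_congr fun y _ => ?_
  rw [similarity, similarity, add_sub_add_left_eq_sub, ← smul_sub, smul_smul]
  congr 1
  field_simp

theorem tangentSets_similarity (q x : EuclideanSpace ℝ (Fin d)) {r : ℝ} (hr : 0 < r)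
    (Y : Set (EuclideanSpace ℝ (Fin d))) :
    tangentSets (similarity q r '' Y) (similarity q r x) = tangentSets Y x := by
  ext F
  constructor
  · rintro ⟨hF, t, ht, hanti, hlim, hconv⟩
    refine ⟨hF, fun n => r⁻¹ * t n, fun n => mul_pos (inv_pos.2 hr) (ht n),
      fun m n hmn => mul_le_mul_of_nonneg_left (hanti hmn) (inv_pos.2 hr).le,
      by simpa using hlim.const_mul r⁻¹, hconv.congr fun n => ?_⟩
    rw [← zoom_similarity q x hr, mul_inv_cancel_left₀ hr.ne']
  · rintro ⟨hF, t, ht, hanti, hlim, hconv⟩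
    refine ⟨hF, fun n => r * t n, fun n => mul_pos hr (ht n),
      fun m n hmn => mul_le_mul_of_nonneg_left (hanti hmn) hr.le,
      by simpa using hlim.const_mul r, hconv.congr fun n => ?_⟩
    rw [zoom_similarity q x hr]

/-- To be a tangent set it suffices to be approximated at arbitrarily small scales. -/
theorem mem_tangentSets_of_forall_exists {x : EuclideanSpace ℝ (Fin d)}
    {X F : Set (EuclideanSpace ℝ (Fin d))} (hF : F ∈ compactsInQ d)
    (h : ∀ ε > 0, ∃ t, 0 < t ∧ t < ε ∧
      Metric.hausdorffEDist (zoom x t X) F ≤ ENNReal.ofReal ε) : F ∈ tangentSets X x := by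
  choose! t ht htε hd using h
  -- Each tolerance is at most the scale chosen before it, which makes the scales decrease; the
  -- bound `1 / (n + 1)` sends them to zero.
  let e : ℕ → ℝ := fun n => Nat.rec 1 (fun n a => min (t a) (1 / ((n : ℝ) + 1))) n
  have he : ∀ n, 0 < e n := fun n => by
    induction n with
    | zero => exact one_pos
    | succ n ih => exact lt_min (ht _ ih) Nat.one_div_pos_of_nat
  have hle : ∀ n, e (n + 1) ≤ t (e n) := fun n => min_le_left _ _
  have hlim : Tendsto e atTop (𝓝 0) := by
    rw [← tendsto_add_atTop_iff_nat 1]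
    exact squeeze_zero (fun n => (he (n + 1)).le) (fun n => min_le_right _ _)
      tendsto_one_div_add_atTop_nhds_zero_nat
  refine ⟨hF, fun n => t (e n), fun n => ht _ (he n),
    antitone_nat_of_succ_le fun n => (htε (e (n + 1)) (he (n + 1))).le.trans (hle n),
    squeeze_zero (fun n => (ht _ (he n)).le) (fun n => (htε _ (he n)).le) hlim, ?_⟩
  refine tendsto_of_tendsto_of_tendsto_of_le_of_le tendsto_const_nhds ?_
    (fun n => zero_le) (fun n => hd _ (he n))
  simpa using ENNReal.tendsto_ofReal hlim

theorem tangentSets_subset_compactsZeroPlus [NeZero d] {X : Set (EuclideanSpace ℝ (Fin d))}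
    (h0 : 0 ∈ X) (hX : ∀ x ∈ X, 0 ≤ x (0 : Fin d)) : tangentSets X 0 ⊆ compactsZeroPlus d := by
  rintro F ⟨hF, t, ht, -, -, hconv⟩
  have hz : ∀ n, (0 : EuclideanSpace ℝ (Fin d)) ∈ zoom 0 (t n) X := fun n =>
    ⟨⟨0, h0, by simp⟩, fun i => by simp⟩
  refine ⟨hF, ?_, fun x hx => ?_⟩
  · rw [← hF.2.1.isClosed.closure_eq, Metric.mem_closure_iff_infEDist_zero]
    exact le_zero_iff.1 (ge_of_tendsto' hconv fun n =>
      Metric.infEDist_le_hausdorffEDist_of_mem (hz n))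
  · have hH : IsClosed {x : EuclideanSpace ℝ (Fin d) | 0 ≤ x (0 : Fin d)} :=
      isClosed_le continuous_const (by fun_prop)
    change x ∈ {x : EuclideanSpace ℝ (Fin d) | 0 ≤ x (0 : Fin d)}
    rw [← hH.closure_eq, Metric.mem_closure_iff_infEDist_zero]
    refine le_zero_iff.1 (ge_of_tendsto' hconv fun n => ?_)
    rw [Metric.hausdorffEDist_comm]
    refine le_trans (Metric.infEDist_anti ?_) (Metric.infEDist_le_hausdorffEDist_of_mem hx)
    rintro _ ⟨⟨y, hy, rfl⟩, -⟩
    simpa using mul_nonneg (inv_pos.2 (ht n)).le (hX y hy)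

end tangent

/-! ### A sequence of points with universal blow-ups at the origin -/

/-- There is a sequence of finite sets of nonzero points of the half cube such that every member of
`𝒦₀⁺` is approximated by infinitely many of them, up to the origin. -/
theorem exists_seq_finset_approx (d : ℕ) [NeZero d] :
    ∃ F : ℕ → Finset (EuclideanSpace ℝ (Fin d)),
      (∀ k, ∀ f ∈ F k, f ∈ cubeQ d ∧ f ≠ 0 ∧ 0 ≤ f (0 : Fin d)) ∧
      ∀ K ∈ compactsZeroPlus d, ∀ ε > 0, ∀ N, ∃ k ≥ N,
        (∀ x ∈ K, ∃ f, (f = 0 ∨ f ∈ F k) ∧ dist f x < ε) ∧ ∀ f ∈ F k, ∃ x ∈ K, dist f x < ε := by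
  obtain ⟨D, hDS, hDc, hSD⟩ := (TopologicalSpace.IsSeparable.of_separableSpace
    {x : EuclideanSpace ℝ (Fin d) | x ∈ cubeQ d ∧ x ≠ 0 ∧ 0 ≤ x (0 : Fin d)}
    ).exists_countable_dense_subset
  have := hDc.to_subtype
  obtain ⟨g, hg⟩ := exists_surjective_nat (Finset D)
  -- Using only the first half of the unpaired index repeats every finite set infinitely often.
  refine ⟨fun k => (g k.unpair.1).map (Function.Embedding.subtype _), fun k f hf => ?_,
    fun K hK ε hε N => ?_⟩
  · obtain ⟨y, -, rfl⟩ := Finset.mem_map.1 hf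
    exact hDS y.2
  obtain ⟨b, hb, hbfin, hKb⟩ := hK.1.2.1.elim_finite_subcover_image
    (b := insert 0 {y ∈ D | ∃ x ∈ K, dist y x < ε}) (c := fun y => Metric.ball y ε)
    (fun _ _ => Metric.isOpen_ball) (fun x hx => by
      by_cases h0 : x = 0
      · exact Set.mem_biUnion (Set.mem_insert _ _) (by simpa [h0] using hε)
      · obtain ⟨y, hy, hyx⟩ := Metric.mem_closure_iff.1
          (hSD ⟨hK.1.2.2 hx, h0, hK.2.2 x hx⟩) ε hε
        exact Set.mem_biUnion (x := y) (Or.inr ⟨hy, x, hx, by rwa [dist_comm]⟩) hyx)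
  obtain ⟨a, ha⟩ := hg (hbfin.preimage (f := ((↑) : D → _))
    Subtype.val_injective.injOn).toFinset
  refine ⟨Nat.pair a N, Nat.right_le_pair a N, fun x hx => ?_, fun f hf => ?_⟩
  · obtain ⟨y, hy, hyx⟩ := Set.mem_iUnion₂.1 (hKb hx)
    refine ⟨y, ?_, by rwa [dist_comm]⟩
    rcases hb hy with h0 | hyD
    · exact Or.inl h0
    · refine Or.inr (Finset.mem_map.2 ⟨⟨y, hyD.1⟩, ?_, rfl⟩)
      simpa [ha] using hy
  · obtain ⟨y, hy, rfl⟩ := Finset.mem_map.1 hf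
    rw [Nat.unpair_pair, ha, Set.Finite.mem_toFinset] at hy
    rcases hb hy with h0 | hyD
    · exact absurd h0 (hDS y.2).2.1
    · exact hyD.2

/-- A sequence of nonzero points converging to the origin whose blow-ups at the origin approximate
every member of `𝒦₀⁺` at arbitrarily small scales. -/
theorem exists_universal_points (d : ℕ) [NeZero d] :
    ∃ P : Set (EuclideanSpace ℝ (Fin d)),
      (∀ q ∈ P, q ∈ cubeQ d ∧ q ≠ 0 ∧ 0 ≤ q (0 : Fin d)) ∧
      (∀ ε > 0, {q ∈ P | ε ≤ ‖q‖}.Finite) ∧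
      ∀ K ∈ compactsZeroPlus d, ∀ ε > 0, ∃ t, 0 < t ∧ t < ε ∧
        (∀ x ∈ K, ∃ q, (q = 0 ∨ q ∈ P) ∧ t⁻¹ • q ∈ cubeQ d ∧ dist (t⁻¹ • q) x < ε) ∧
        ∀ q ∈ P, ‖q‖ ≤ 2 * d * t → ∃ x ∈ K, dist (t⁻¹ • q) x < ε := by
  obtain ⟨F, hF, hFK⟩ := exists_seq_finset_approx d
  have hd : (1 : ℝ) ≤ d := by exact_mod_cast Nat.one_le_iff_ne_zero.2 (NeZero.ne d)
  have hm : ∀ k, ∃ m : ℝ, 0 < m ∧ m ≤ 1 ∧ ∀ f ∈ F k, m ≤ ‖f‖ := fun k => by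
    obtain ⟨δ, hδ, hδF⟩ := Metric.isOpen_iff.1 (F k).finite_toSet.isClosed.isOpen_compl 0
      (fun h => (hF k 0 h).2.1 rfl)
    refine ⟨min δ 1, lt_min hδ one_pos, min_le_right _ _, fun f hf =>
      (min_le_left _ _).trans (not_lt.1 fun h => hδF (mem_ball_zero_iff.2 h) hf)⟩
  choose m hm0 hm1 hmF using hm
  -- With `m k` a lower bound for the norms in `F k`, this decay puts earlier generations outside
  -- radius `2 * d * t k` and later ones within `t k / (k + 1)` of the origin.
  let t : ℕ → ℝ := fun k => Nat.rec 1 (fun k a => a * m k / (4 * d * (k + 1))) k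
  have hsucc : ∀ k, t (k + 1) = t k * m k / (4 * d * (k + 1)) := fun k => rfl
  have ht0 : ∀ k, 0 < t k := fun k => by
    induction k with
    | zero => exact one_pos
    | succ k ih =>
      rw [hsucc]
      have := hm0 k
      positivity
  have hsucc' : ∀ k, 4 * d * (k + 1) * t (k + 1) = t k * m k := fun k => by
    rw [hsucc]
    field_simp
  have hstep : ∀ k, d * t (k + 1) ≤ t k * (1 / ((k : ℝ) + 1)) := fun k => by
    have h1 : t k * m k ≤ t k := mul_le_of_le_one_right (ht0 k).le (hm1 k)
    rw [mul_one_div, le_div_iff₀ (by positivity)]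
    have h2 : 0 < d * t (k + 1) * (k + 1) := by have := ht0 (k + 1); positivity
    have := hsucc' k
    linarith
  have hanti : Antitone t := antitone_nat_of_succ_le fun k => by
    have h1 : t (k + 1) ≤ d * t (k + 1) := le_mul_of_one_le_left (ht0 (k + 1)).le hd
    have h2 : 1 / ((k : ℝ) + 1) ≤ 1 := by
      rw [div_le_one (by positivity)]
      linarith [(Nat.cast_nonneg k : (0 : ℝ) ≤ k)]
    exact (h1.trans (hstep k)).trans (mul_le_of_le_one_right (ht0 k).le h2)
  have hlim : Tendsto t atTop (𝓝 0) := by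
    rw [← tendsto_add_atTop_iff_nat 1]
    refine squeeze_zero (fun k => (ht0 (k + 1)).le) (fun k => ?_)
      tendsto_one_div_add_atTop_nhds_zero_nat
    have h1 : t (k + 1) ≤ d * t (k + 1) := le_mul_of_one_le_left (ht0 (k + 1)).le hd
    refine (h1.trans (hstep k)).trans (mul_le_of_le_one_left (by positivity) (hanti k.zero_le))
  have hnorm : ∀ k, ∀ f ∈ F k, ‖t k • f‖ ≤ d * t k := fun k f hf => by
    rw [norm_smul, Real.norm_of_nonneg (ht0 k).le, mul_comm]
    exact mul_le_mul_of_nonneg_right (norm_le_of_mem_cubeQ (hF k f hf).1) (ht0 k).le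
  refine ⟨{q | ∃ k, ∃ f ∈ F k, t k • f = q}, ?_, ?_, ?_⟩
  · rintro _ ⟨k, f, hf, rfl⟩
    obtain ⟨hQ, hne, hpos⟩ := hF k f hf
    have ht1 : t k ≤ 1 := hanti k.zero_le
    refine ⟨fun i => ?_, smul_ne_zero (ht0 k).ne' hne, mul_nonneg (ht0 k).le hpos⟩
    refine abs_le.1 ?_
    rw [PiLp.smul_apply, smul_eq_mul, abs_mul, abs_of_pos (ht0 k)]
    exact mul_le_one₀ ht1 (abs_nonneg _) (abs_le.2 (hQ i))
  · intro ε hε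
    have hlim' : Tendsto (fun k => d * t k) atTop (𝓝 0) := by
      simpa using hlim.const_mul (d : ℝ)
    obtain ⟨N, hN⟩ := eventually_atTop.1 (hlim'.eventually_lt_const hε)
    refine ((Set.finite_lt_nat N).biUnion fun k _ =>
      ((F k).finite_toSet.image fun f => t k • f)).subset ?_
    rintro _ ⟨⟨k, f, hf, rfl⟩, hε'⟩
    refine Set.mem_iUnion₂.2 ⟨k, Set.mem_ofPred.2 (not_le.1 fun hk => ?_), f, hf, rfl⟩
    exact absurd (hN k hk) (not_lt.2 (hε'.trans (hnorm k f hf)))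
  · intro K hK ε hε
    obtain ⟨N, hN⟩ := eventually_atTop.1 ((hlim.eventually_lt_const hε).and
      (tendsto_one_div_add_atTop_nhds_zero_nat.eventually_lt_const hε))
    obtain ⟨k, hkN, hKF, hFK⟩ := hFK K hK ε hε N
    have hinv : ∀ f : EuclideanSpace ℝ (Fin d), (t k)⁻¹ • t k • f = f := fun f =>
      inv_smul_smul₀ (ht0 k).ne' f
    refine ⟨t k, ht0 k, (hN k hkN).1, fun x hx => ?_, ?_⟩
    · obtain ⟨f, hf, hfx⟩ := hKF x hx
      refine ⟨t k • f, ?_, ?_, by rwa [hinv]⟩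
      · rcases hf with rfl | hf
        · exact Or.inl (smul_zero _)
        · exact Or.inr ⟨k, f, hf, rfl⟩
      · rw [hinv]
        rcases hf with rfl | hf
        · exact hK.1.2.2 hK.2.1
        · exact (hF k f hf).1
    · rintro _ ⟨l, f, hf, rfl⟩ hle
      rcases lt_trichotomy l k with hlk | rfl | hlk
      · exfalso
        have h1 : t l * m l ≤ ‖t l • f‖ := by
          rw [norm_smul, Real.norm_of_nonneg (ht0 l).le]
          exact mul_le_mul_of_nonneg_left (hmF l f hf) (ht0 l).le
        have h2 : t k ≤ t (l + 1) := hanti hlk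
        have h3 : 4 * d * t k ≤ 4 * d * (l + 1) * t (l + 1) := by
          refine mul_le_mul (le_mul_of_one_le_right (by positivity) ?_) h2 (ht0 k).le (by positivity)
          linarith [(Nat.cast_nonneg l : (0 : ℝ) ≤ l)]
        have h4 : 0 < d * t k := mul_pos (by linarith) (ht0 k)
        have := hsucc' l
        linarith
      · rw [hinv]
        exact hFK f hf
      -- Later generations collapse to the origin, which belongs to `K`.
      · refine ⟨0, hK.2.1, ?_⟩
        rw [dist_zero_right, norm_smul, norm_inv, Real.norm_of_nonneg (ht0 k).le,
          inv_mul_lt_iff₀ (ht0 k)]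
        calc ‖t l • f‖ ≤ d * t l := hnorm l f hf
          _ ≤ d * t (k + 1) := by gcongr; exact hanti hlk
          _ ≤ t k * (1 / ((k : ℝ) + 1)) := hstep k
          _ < t k * ε := mul_lt_mul_of_pos_left (hN k hkN).2 (ht0 k)

/-! ### The recursive set and its dimension -/

section words

variable {V : Type*} [NormedAddCommGroup V] [NormedSpace ℝ V] {P : Set V} {r : ℕ → V → ℝ} {B : ℝ}

/-- The image of the origin under the composition of the similarities given by the word `w`, where
the letter `q` in position `k` stands for the similarity `y ↦ q + r (n + k) q • y`. -/
def wordPoint (r : ℕ → V → ℝ) : ℕ → List P → V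
  | _, [] => 0
  | n, q :: w => similarity (q : V) (r n q) (wordPoint r (n + 1) w)

/-- The set of all points given by words over `P`. -/
def wordSet (P : Set V) (r : ℕ → V → ℝ) (n : ℕ) : Set V := Set.range (wordPoint (P := P) r n)

theorem wordSet_eq_attach (n : ℕ) :
    wordSet P r n = attach {0} P (r n) (wordSet P r (n + 1)) := by
  ext x
  rw [mem_attach]
  constructor
  · rintro ⟨_ | ⟨q, w⟩, rfl⟩
    · exact Or.inl rfl
    · exact Or.inr ⟨q, q.2, _, ⟨w, rfl⟩, rfl⟩
  · rintro (hx | ⟨q, hq, _, ⟨w, rfl⟩, rfl⟩)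
    · exact ⟨[], (Set.mem_singleton_iff.1 hx).symm⟩
    · exact ⟨⟨q, hq⟩ :: w, rfl⟩

theorem zero_mem_wordSet (n : ℕ) : (0 : V) ∈ wordSet P r n := ⟨[], rfl⟩

theorem countable_wordSet (hP : P.Countable) (n : ℕ) : (wordSet P r n).Countable := by
  have := hP.to_subtype
  exact Set.countable_range _

theorem wordSet_subset_closedBall (hB : 0 ≤ B) (hP : ∀ q ∈ P, ‖q‖ ≤ B)
    (hr0 : ∀ n, ∀ q ∈ P, 0 ≤ r n q) (hr : ∀ n, ∀ q ∈ P, r n q ≤ 1 / 2) (n : ℕ) :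
    wordSet P r n ⊆ Metric.closedBall 0 (2 * B) := by
  rintro _ ⟨w, rfl⟩
  rw [mem_closedBall_zero_iff]
  induction w generalizing n with
  | nil => simpa [wordPoint] using hB
  | cons q w ih =>
    refine (norm_add_le _ _).trans ?_
    rw [norm_smul, Real.norm_of_nonneg (hr0 n q q.2)]
    have h1 := mul_le_mul (hr n q q.2) (ih (n + 1)) (norm_nonneg _) (by norm_num)
    have := hP q q.2
    linarith

theorem closure_wordSet_eq_attach [FiniteDimensional ℝ V] (hsep : ∀ n, IsSeparated {0} P B (r n))
    (hbdd : ∀ n, wordSet P r n ⊆ Metric.closedBall 0 B) (n : ℕ) :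
    closure (wordSet P r n) = attach {0} P (r n) (closure (wordSet P r (n + 1))) := by
  have hsub : closure (wordSet P r (n + 1)) ⊆ Metric.closedBall 0 B :=
    closure_minimal (hbdd (n + 1)) Metric.isClosed_closedBall
  have hcomp : IsCompact (closure (wordSet P r (n + 1))) :=
    (isCompact_closedBall 0 B).of_isClosed_subset isClosed_closure hsub
  refine (closure_minimal ?_ ((hsep n).isCompact_attach isCompact_singleton
    (Set.singleton_nonempty _) hcomp hsub).isClosed).antisymm ?_
  · rw [wordSet_eq_attach n]
    exact Set.union_subset_union_right _ (Set.iUnion₂_mono fun q _ =>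
      Set.image_mono subset_closure)
  · rintro x hx
    rcases mem_attach.1 hx with hx | ⟨q, hq, y, hy, rfl⟩
    · rw [Set.mem_singleton_iff.1 hx]
      exact subset_closure (zero_mem_wordSet n)
    · rw [wordSet_eq_attach n]
      refine closure_mono (fun z hz => mem_attach.2 (Or.inr ?_))
        (image_closure_subset_closure_image (lipschitzWith_similarity q (r n q)).continuous
          ⟨y, hy, rfl⟩)
      obtain ⟨y', hy', rfl⟩ := hz
      exact ⟨q, hq, y', hy', rfl⟩

/-- From level `N` on, the ratios are `a q ^ (N + k + 1)`, whose powers with exponent `1 / (N + 1)`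
are at most `a q` and so have sum at most one. Level `N` thus has dimension at most `1 / (N + 1)`.
Passing from one level to the next does not lower the dimension, so level `n` is bounded by all
these numbers. -/
theorem dimH_closure_wordSet_eq_zero {V' : Type} [NormedAddCommGroup V']
    [NormedSpace ℝ V'] [FiniteDimensional ℝ V'] {P : Set V'} {r : ℕ → V' → ℝ}
    (hP : P.Countable) (hsep : ∀ n, IsSeparated {0} P B (r n))
    (hbdd : ∀ n, wordSet P r n ⊆ Metric.closedBall 0 B)
    {a : V' → ℝ} (ha0 : ∀ q ∈ P, 0 < a q) (ha : ∀ q ∈ P, a q ≤ 1 / 2)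
    (hr : ∀ n, ∀ q ∈ P, r n q = a q ^ (n + 1))
    (hsum : ∑' q : P, ENNReal.ofReal (a q) ≤ 1) (n : ℕ) :
    dimH (closure (wordSet P r n)) = 0 := by
  have := hP.to_subtype
  have hrec := closure_wordSet_eq_attach hsep hbdd
  have hle : ∀ k, dimH (closure (wordSet P r n)) ≤ dimH (closure (wordSet P r (n + k))) := by
    intro k
    induction k with
    | zero => exact le_rfl
    | succ k ih =>
      refine ih.trans ?_
      rw [hrec (n + k)]
      exact (dimH_attach_le hP).trans (by simp [add_assoc])
  have hbound : ∀ N, dimH (closure (wordSet P r N)) ≤ ((1 / ((N : NNReal) + 1) : NNReal)) := by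
    intro N
    have h := dimH_le_of_subset_iUnion_similarity (s := 1 / ((N : NNReal) + 1))
      (b := Metric.ediam (Metric.closedBall (0 : V') B)) Metric.isBounded_closedBall.ediam_ne_top
      (fun q : P => (q : V')) (fun k q => r (N + k) q)
      -- The origin need not lie in any of the copies, so the countable set of word points, of
      -- dimension zero, is removed before covering.
      (fun k => closure (wordSet P r (N + k)) \ wordSet P r (N + k))
      (fun k q => ((hsep _).pos q q.2).le) (fun k q => ?_) (fun k => ?_) (fun k => ?_)
      (fun k => Metric.ediam_mono (Set.sdiff_subset.trans
        (closure_minimal (hbdd _) Metric.isClosed_closedBall))) 0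
    · calc dimH (closure (wordSet P r N))
          ≤ dimH (wordSet P r N ∪ closure (wordSet P r N) \ wordSet P r N) :=
            dimH_mono (by rw [Set.union_sdiff_self]; exact Set.subset_union_right)
        _ ≤ _ := by
          rw [dimH_union, dimH_countable (countable_wordSet hP N)]
          simpa using h
    · rw [hr _ _ q.2]
      exact (pow_le_of_le_one (ha0 q q.2).le ((ha q q.2).trans (by norm_num))
        (Nat.succ_ne_zero _)).trans (ha q q.2)
    · refine (ENNReal.tsum_le_tsum fun q => ?_).trans hsum
      have h0 := ha0 q q.2
      rw [hr _ _ q.2, ENNReal.ofReal_rpow_of_pos (by positivity)]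
      refine ENNReal.ofReal_le_ofReal ?_
      rw [← Real.rpow_natCast, ← Real.rpow_mul h0.le]
      refine (Real.rpow_le_rpow_of_exponent_ge h0 ((ha q q.2).trans (by norm_num)) ?_).trans_eq
        (Real.rpow_one _)
      push_cast
      rw [mul_one_div, one_le_div (by positivity)]
      linarith [(Nat.cast_nonneg k : (0 : ℝ) ≤ k)]
    · rintro x ⟨hx, hxE⟩
      rw [hrec] at hx
      rw [wordSet_eq_attach, mem_attach] at hxE
      push Not at hxE
      rcases mem_attach.1 hx with hx | ⟨q, hq, y, hy, rfl⟩
      · exact absurd hx hxE.1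
      · exact Set.mem_iUnion.2 ⟨⟨q, hq⟩, y, ⟨hy, fun hyE => hxE.2 q hq y hyE rfl⟩, rfl⟩
  refine le_zero_iff.1 (ge_of_tendsto' (x := atTop)
    (f := fun k : ℕ => ((1 / (((n + k : ℕ) : NNReal) + 1) : NNReal) : ENNReal)) ?_
    fun k => (hle k).trans (hbound (n + k)))
  rw [← ENNReal.coe_zero, ENNReal.tendsto_coe]
  have h := (tendsto_one_div_add_atTop_nhds_zero_nat (𝕜 := NNReal)).comp (tendsto_add_atTop_nat n)
  refine h.congr fun k => ?_
  simp [add_comm]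

end words

/-! ### The zero-dimensional set with universal tangents -/

/-- There is a compact set of dimension zero with a countable dense subset at all of whose points
the tangent sets are exactly the members of `𝒦₀⁺`. -/
theorem exists_dimH_eq_zero_tangentSets_eq (d : ℕ) [NeZero d] :
    ∃ Y E : Set (EuclideanSpace ℝ (Fin d)), IsCompact Y ∧ E ⊆ Y ∧ Y ⊆ closure E ∧ E.Countable ∧
      0 ∈ E ∧ dimH Y = 0 ∧ ∀ x ∈ E, tangentSets Y x = compactsZeroPlus d := by
  obtain ⟨P, hPQ, hPfin, hPK⟩ := exists_universal_points d
  have hd : (1 : ℝ) ≤ d := by exact_mod_cast Nat.one_le_iff_ne_zero.2 (NeZero.ne d)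
  have hdisj : Disjoint {0} P := Set.disjoint_singleton_left.2 fun h => (hPQ 0 h).2.1 rfl
  have hfin : ∀ ε > 0, {q ∈ P | ε ≤ Metric.infDist q {0}}.Finite := by simpa using hPfin
  have hPc : P.Countable :=
    countable_of_finite_infDist isClosed_singleton (Set.singleton_nonempty _) hdisj hfin
  obtain ⟨ρ, hρ0, hρ⟩ := exists_forall_isSeparated (B := 2 * d) (by positivity)
    isClosed_singleton (Set.singleton_nonempty _) hdisj hfin
  have := hPc.to_subtype
  obtain ⟨b, hb0, hbsum⟩ := ENNReal.exists_pos_sum_of_countable (one_ne_zero : (1 : ENNReal) ≠ 0) P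
  classical
  -- The bounds give, in order: summability, separation, contraction by `1 / 2`, and copies of size
  -- at most `‖q‖ ^ 2`.
  let a : EuclideanSpace ℝ (Fin d) → ℝ := fun q =>
    min (if h : q ∈ P then (b ⟨q, h⟩ : ℝ) else 1) (min (ρ q) (min (1 / 2) (‖q‖ ^ 2 / (2 * d))))
  let r : ℕ → EuclideanSpace ℝ (Fin d) → ℝ := fun n q => a q ^ (n + 1)
  have ha0 : ∀ q ∈ P, 0 < a q := fun q hq => by
    have h1 := norm_pos_iff.2 (hPQ q hq).2.1
    refine lt_min ?_ (lt_min (hρ0 q hq) (lt_min (by norm_num) (by positivity)))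
    rw [dif_pos hq]
    exact NNReal.coe_pos.2 (hb0 _)
  have hab : ∀ q : P, a q ≤ b q := fun q => by
    refine (min_le_left _ _).trans ?_
    rw [dif_pos q.2]
  have haρ : ∀ q, a q ≤ ρ q := fun q => (min_le_right _ _).trans (min_le_left _ _)
  have ha2 : ∀ q, a q ≤ 1 / 2 := fun q =>
    (min_le_right _ _).trans ((min_le_right _ _).trans (min_le_left _ _))
  have haq : ∀ q, a q * (2 * d) ≤ ‖q‖ ^ 2 := fun q => by
    rw [← le_div_iff₀ (by positivity)]
    exact (min_le_right _ _).trans ((min_le_right _ _).trans (min_le_right _ _))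
  have hr0 : ∀ n, ∀ q ∈ P, 0 < r n q := fun n q hq => pow_pos (ha0 q hq) _
  have hra : ∀ n, ∀ q ∈ P, r n q ≤ a q := fun n q hq =>
    pow_le_of_le_one (ha0 q hq).le ((ha2 q).trans (by norm_num)) (Nat.succ_ne_zero _)
  have hsep : ∀ n, IsSeparated {0} P (2 * d) (r n) := fun n =>
    hρ _ fun q hq => ⟨hr0 n q hq, (hra n q hq).trans (haρ q)⟩
  have hbdd := wordSet_subset_closedBall (P := P) (r := r) (B := d) (by positivity)
    (fun q hq => norm_le_of_mem_cubeQ (hPQ q hq).1) (fun n q hq => (hr0 n q hq).le)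
    (fun n q hq => (hra n q hq).trans (ha2 q))
  have hrec := closure_wordSet_eq_attach hsep hbdd
  have hcl : ∀ n, closure (wordSet P r n) ⊆ Metric.closedBall 0 (2 * d) := fun n =>
    closure_minimal (hbdd n) Metric.isClosed_closedBall
  have hhalf : ∀ n, ∀ x ∈ closure (wordSet P r n), 0 ≤ x (0 : Fin d) := fun n => by
    have hH : IsClosed {x : EuclideanSpace ℝ (Fin d) | 0 ≤ x (0 : Fin d)} :=
      isClosed_le continuous_const (by fun_prop)
    refine closure_minimal ?_ hH
    rintro _ ⟨w, rfl⟩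
    induction w generalizing n with
    | nil => exact le_refl (0 : ℝ)
    | cons q w ih =>
      exact add_nonneg (hPQ q q.2).2.2 (mul_nonneg (hr0 n q q.2).le (ih (n + 1)))
  have hzero : ∀ n, tangentSets (closure (wordSet P r n)) 0 = compactsZeroPlus d := by
    intro n
    refine (tangentSets_subset_compactsZeroPlus (subset_closure (zero_mem_wordSet n))
      (hhalf n)).antisymm fun K hK => mem_tangentSets_of_forall_exists hK.1 fun ε hε => ?_
    -- Half of `ε` pays for approximating `K` by `P`. The second bound makes `(2 * d * t) ^ 2 / t ≤
    -- ε / 2`, the rescaled size of a visible copy.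
    obtain ⟨t, ht0, htε, hKP, hPK⟩ := hPK K hK (min (ε / 2) (ε / (8 * d ^ 2)))
      (lt_min (half_pos hε) (by positivity))
    have htε1 : t < ε / 2 := htε.trans_le (min_le_left _ _)
    have htε2 : t * (8 * d ^ 2) < ε :=
      (lt_div_iff₀ (by positivity)).1 (htε.trans_le (min_le_right _ _))
    refine ⟨t, ht0, by linarith, Metric.hausdorffEDist_le_of_mem_edist ?_ ?_⟩
    · rintro _ ⟨⟨y, hy, rfl⟩, hQ⟩
      simp only [sub_zero] at hQ ⊢
      rw [hrec n] at hy
      rcases mem_attach.1 hy with hy | ⟨q, hq, x, hx, rfl⟩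
      · refine ⟨0, hK.2.1, ?_⟩
        rw [Set.mem_singleton_iff.1 hy, smul_zero, edist_self]
        exact zero_le
      · have h1 := mem_closedBall_iff_norm.1
          (similarity_mem_closedBall (hr0 n q hq).le (hcl (n + 1) hx) (q := q))
        have h2 : 4 * (r n q * (2 * d)) ≤ ‖q‖ := by simpa using (hsep n).le_infDist q hq
        have h3 : ‖similarity q (r n q) x‖ ≤ t * d := by
          have := norm_le_of_mem_cubeQ hQ
          rwa [norm_smul, norm_inv, Real.norm_of_nonneg ht0.le, inv_mul_le_iff₀ ht0] at this
        -- A point of the copy at `q` is within `‖q‖ / 4` of `q`, so if it is visible then `q` is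
        -- nearly so.
        have h4 : ‖q‖ ≤ 2 * d * t := by
          have h5 := norm_le_norm_add_norm_sub' q (similarity q (r n q) x)
          rw [norm_sub_rev] at h5
          have := norm_nonneg q
          linarith
        obtain ⟨z, hz, hqz⟩ := hPK q hq h4
        refine ⟨z, hz, ?_⟩
        rw [edist_dist]
        refine ENNReal.ofReal_le_ofReal ?_
        have h6 : dist (t⁻¹ • similarity q (r n q) x) (t⁻¹ • q) ≤ ε / 2 := by
          rw [dist_eq_norm, ← smul_sub, norm_smul, norm_inv, Real.norm_of_nonneg ht0.le,
            inv_mul_le_iff₀ ht0]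
          calc _ ≤ r n q * (2 * d) := h1
            _ ≤ a q * (2 * d) := by gcongr; exact hra n q hq
            _ ≤ ‖q‖ ^ 2 := haq q
            _ ≤ (2 * d * t) ^ 2 := by gcongr
            _ = t * (t * (8 * d ^ 2) / 2) := by ring
            _ ≤ t * (ε / 2) := by gcongr
        have h7 := hqz.trans_le (min_le_left _ _)
        have h8 := dist_triangle (t⁻¹ • similarity q (r n q) x) (t⁻¹ • q) z
        linarith
    · intro x hx
      obtain ⟨q, hq, hqQ, hqx⟩ := hKP x hx
      refine ⟨t⁻¹ • q, ⟨⟨q, ?_, by simp⟩, hqQ⟩, ?_⟩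
      · rcases hq with rfl | hq
        · exact subset_closure (zero_mem_wordSet n)
        · exact subset_closure ⟨[⟨q, hq⟩], by simp [wordPoint, similarity]⟩
      · rw [edist_comm, edist_dist]
        exact ENNReal.ofReal_le_ofReal
          ((hqx.trans_le (min_le_left _ _)).le.trans (by linarith))
  have htan : ∀ (w : List P) (n : ℕ),
      tangentSets (closure (wordSet P r n)) (wordPoint r n w) = compactsZeroPlus d := by
    intro w
    induction w with
    | nil => exact hzero
    | cons q w ih =>
      intro n
      rw [← ih (n + 1), hrec n, wordPoint,
        tangentSets_congr_of_inter_ball (mul_pos (hr0 n q q.2) (by positivity))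
          ((hsep n).attach_inter_ball_similarity (by positivity) (hcl (n + 1)) q.2
            (subset_closure ⟨w, rfl⟩)), tangentSets_similarity _ _ (hr0 n q q.2)]
  refine ⟨closure (wordSet P r 0), wordSet P r 0,
    (isCompact_closedBall 0 (2 * (d : ℝ))).of_isClosed_subset isClosed_closure (hcl 0),
    subset_closure, le_rfl, countable_wordSet hPc 0, zero_mem_wordSet 0,
    dimH_closure_wordSet_eq_zero hPc hsep hbdd ha0 (fun q _ => ha2 q) (fun _ _ _ => rfl) ?_ 0, ?_⟩
  · refine (ENNReal.tsum_le_tsum fun q => ?_).trans hbsum.le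
    rw [← ENNReal.ofReal_coe_nnreal]
    exact ENNReal.ofReal_le_ofReal (hab q)
  · rintro _ ⟨w, rfl⟩
    exact htan w 0

/-! ### Attaching the zero-dimensional set along a set of dimension `s` -/

/-- A compact set with empty interior is the set of accumulation points of a subset of its
complement. -/
theorem exists_accumulating_points {V : Type*} [NormedAddCommGroup V] {C : Set V}
    (hC : IsCompact C) (hint : interior C = ∅) {η : ℝ} (hη : 0 < η) :
    ∃ P : Set V, Disjoint C P ∧ (∀ q ∈ P, Metric.infDist q C < η) ∧ C ⊆ closure P ∧
      ∀ ε > 0, {q ∈ P | ε ≤ Metric.infDist q C}.Finite := by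
  have hδ : ∀ n : ℕ, 0 < min η (1 / ((n : ℝ) + 1)) := fun n =>
    lt_min hη Nat.one_div_pos_of_nat
  have hfar : ∀ (n : ℕ) (x : V), ∃ q, q ∉ C ∧ dist q x < min η (1 / ((n : ℝ) + 1)) := fun n x => by
    by_contra! h
    have hx : x ∈ interior C := mem_interior.2 ⟨_, fun q hq => by
      by_contra hqC
      exact (h q hqC).not_gt hq, Metric.isOpen_ball, Metric.mem_ball_self (hδ n)⟩
    simp [hint] at hx
  choose f hfC hf using hfar
  -- A finite net of `C` at each scale, pushed off `C`, gives density along `C` yet finitely many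
  -- points away from it.
  choose N hNC hNfin hN using fun n => hC.finite_cover_balls (hδ n)
  have hinf : ∀ n, ∀ x ∈ N n, Metric.infDist (f n x) C < min η (1 / ((n : ℝ) + 1)) :=
    fun n x hx => (Metric.infDist_le_dist_of_mem (hNC n hx)).trans_lt (hf n x)
  refine ⟨{q | ∃ n, ∃ x ∈ N n, f n x = q}, ?_, ?_, ?_, ?_⟩
  · rw [Set.disjoint_right]
    rintro _ ⟨n, x, -, rfl⟩
    exact hfC n x
  · rintro _ ⟨n, x, hx, rfl⟩
    exact (hinf n x hx).trans_le (min_le_left _ _)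
  · intro x hx
    rw [Metric.mem_closure_iff]
    intro ε hε
    obtain ⟨n, hn⟩ := exists_nat_one_div_lt (half_pos hε)
    obtain ⟨y, hy, hxy⟩ := Set.mem_iUnion₂.1 (hN n hx)
    refine ⟨f n y, ⟨n, y, hy, rfl⟩, ?_⟩
    have h1 := (hf n y).trans_le (min_le_right _ _)
    have h2 := (Metric.mem_ball.1 hxy).trans_le (min_le_right _ _)
    have h3 := dist_triangle_right x (f n y) y
    linarith
  · intro ε hε
    obtain ⟨M, hM⟩ := eventually_atTop.1
      (tendsto_one_div_add_atTop_nhds_zero_nat.eventually_lt_const hε)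
    refine ((Set.finite_lt_nat M).biUnion fun n _ => (hNfin n).image (f n)).subset ?_
    rintro _ ⟨⟨n, x, hx, rfl⟩, hle⟩
    refine Set.mem_iUnion₂.2 ⟨n, Set.mem_ofPred.2 (not_le.1 fun hn => ?_), x, hx, rfl⟩
    exact absurd (hM n hn) (not_lt.2 (hle.trans ((hinf n x hx).trans_le (min_le_right _ _)).le))

theorem corollary5p2 (d : ℕ) [NeZero d] (s : ℝ) (hs : s ∈ Set.Icc (0 : ℝ) d) :
    ∃ X ∈ compactsInQ d, dimH X = ENNReal.ofReal s ∧
      ∃ E : Set (EuclideanSpace ℝ (Fin d)), E ⊆ X ∧ E.Countable ∧ X ⊆ closure E ∧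
        ∀ x ∈ E, tangentSets X x = compactsZeroPlus d := by
  obtain ⟨C, hC, hne, hint, hCball, hCdim⟩ :=
    exists_isCompact_subset_closedBall_dimH_eq d hs (one_half_pos (α := ℝ))
  obtain ⟨Y, E, hY, hEY, hYE, hEc, hE0, hYdim, hEtan⟩ := exists_dimH_eq_zero_tangentSets_eq d
  obtain ⟨P, hdisj, hPC, hCP, hPfin⟩ := exists_accumulating_points hC hint
    (by norm_num : (0 : ℝ) < 1 / 4)
  have hPc := countable_of_finite_infDist hC.isClosed hne hdisj hPfin
  obtain ⟨B, hB, hYB⟩ := hY.isBounded.exists_pos_norm_le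
  have hYball : Y ⊆ Metric.closedBall 0 B := fun y hy => mem_closedBall_zero_iff.2 (hYB y hy)
  obtain ⟨r, hr0, hr⟩ := exists_forall_isSeparated hB hC.isClosed hne hdisj hPfin
  have hsep : IsSeparated C P B r := hr r fun q hq => ⟨hr0 q hq, le_rfl⟩
  -- `C` lies within `1 / 2` of the origin, `P` within `1 / 4` of `C`, and separation keeps each
  -- copy within `1 / 16` of its centre.
  have hX : attach C P r Y ⊆ cubeQ d := by
    refine Set.Subset.trans (fun x hx => ?_) closedBall_subset_cubeQ
    rcases mem_attach.1 hx with hx | ⟨q, hq, y, hy, rfl⟩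
    · exact Metric.closedBall_subset_closedBall (by norm_num) (hCball hx)
    · obtain ⟨c, hc, hqc⟩ := (Metric.infDist_lt_iff hne).1 (hPC q hq)
      have h1 := hsep.le_infDist q hq
      have h2 := Metric.mem_closedBall.1
        (similarity_mem_closedBall (hr0 q hq).le (hYball hy) (q := q))
      have h3 := Metric.mem_closedBall.1 (hCball hc)
      have h4 := hPC q hq
      have h5 := dist_triangle4 (similarity q (r q) y) q c 0
      rw [Metric.mem_closedBall]
      linarith
  refine ⟨attach C P r Y, ⟨hne.mono Set.subset_union_left,
    hsep.isCompact_attach hC hne hY hYball, hX⟩, ?_, ⋃ q ∈ P, similarity q (r q) '' E, ?_,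
    hPc.biUnion fun q _ => hEc.image _, ?_, ?_⟩
  · refine le_antisymm ((dimH_attach_le hPc).trans ?_) ?_
    · rw [hCdim, hYdim, max_eq_left zero_le]
    · rw [← hCdim]
      exact dimH_mono Set.subset_union_left
  · exact Set.subset_union_of_subset_right (Set.iUnion₂_mono fun q _ => Set.image_mono hEY) _
  · refine Set.union_subset (hCP.trans (closure_mono fun q hq => ?_))
      (Set.iUnion₂_subset fun q hq => ?_)
    · exact Set.mem_biUnion hq ⟨0, hE0, by simp [similarity]⟩
    · refine (Set.image_mono hYE).trans ((image_closure_subset_closure_image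
        (lipschitzWith_similarity q (r q)).continuous).trans (closure_mono ?_))
      exact Set.subset_biUnion_of_mem (u := fun q => similarity q (r q) '' E) hq
  · intro x hx
    obtain ⟨q, hq, y, hy, rfl⟩ := Set.mem_iUnion₂.1 hx
    rw [tangentSets_congr_of_inter_ball (mul_pos (hr0 q hq) hB)
      (hsep.attach_inter_ball_similarity hB hYball hq (hEY hy)),
      tangentSets_similarity _ _ (hr0 q hq), hEtan y hy]
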